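/- For $s\in\mathbb{R}$ and integers $n\ge 1$ put $h_s(n)=n^s$. Define polynomials by $P_0^{h_s}(x)=1$ and $$P_n^{h_s}(x)=\frac{x}{h_s(n)}\sum_{k=0}^{n-1}P_k^{h_s}(x)\qquad(n\ge 1),$$ and let $A_{n,k}(s)$ be their coefficients, $P_n^{h_s}(x)=\sum_{k=0}^{n}A_{n,k}(s)\,x^k$. Theorem. Let $s\in[0,1]$. Then there exist real sequences $(a_n(s))_n$ and $(b_n(s))_n$, with $b_n(s)>0$ for all but finitely many $n$, such that $$\lim_{n\to\infty}\ \sup_{x\in\mathbb{R}}\left|\frac{1}{P_n^{h_s}(1)}\sum_{\substack{0\le k\le n\\ k\le a_n(s)+x\,b_n(s)}}A_{n,k}(s)-\frac{1}{\sqrt{2\pi}}\int_{-\infty}^{x}e^{-t^2/2}\,dt\right|=0,$$ where the supremum is finite for every $n$. -/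

import Mathlib

/-- The weight function `h_s(n) = n ^ s` (only its values at `n ≥ 1` are used below). -/
noncomputable def hWeight (s : ℝ) (n : ℕ) : ℝ := (n : ℝ) ^ s

/-- The polynomials `P_n^h(x)` attached to a weight `h`: `P_0^h = 1` and, for `n ≥ 1`,
`P_n^h(x) = (x / h(n)) * ∑_{k = 0}^{n - 1} P_k^h(x)`. -/
noncomputable def recPoly (h : ℕ → ℝ) : ℕ → Polynomial ℝ
  | 0 => 1
  | n + 1 => Polynomial.C (1 / h (n + 1)) * Polynomial.X * ∑ k : Fin (n + 1), recPoly h k.val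
  decreasing_by exact k.isLt

theorem recPoly_zero (h : ℕ → ℝ) : recPoly h 0 = 1 := by
  rw [recPoly]

/-- The defining recursion, with the sum written over `0 ≤ k ≤ n - 1`. -/
theorem recPoly_of_pos (h : ℕ → ℝ) (n : ℕ) (hn : 1 ≤ n) :
    recPoly h n =
      Polynomial.C (1 / h n) * Polynomial.X * ∑ k ∈ Finset.range n, recPoly h k := by
  obtain ⟨m, rfl⟩ : ∃ m, n = m + 1 := ⟨n - 1, by omega⟩
  rw [recPoly, Fin.sum_univ_eq_sum_range (fun k => recPoly h k) (m + 1)]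

/-- The double sequence `A_{n,k}(s)`: the coefficient of `x ^ k` in `P_n^{h_s}(x)`. -/
noncomputable def coeffA (s : ℝ) (n k : ℕ) : ℝ := (recPoly (hWeight s) n).coeff k

/-- The normalised partial sum `(1 / P_n^{h_s}(1)) * ∑_{0 ≤ k ≤ n, k ≤ y} A_{n,k}(s)`. -/
noncomputable def normPartialSum (s : ℝ) (n : ℕ) (y : ℝ) : ℝ :=
  1 / (recPoly (hWeight s) n).eval 1 *
    ∑ k ∈ (Finset.range (n + 1)).filter (fun k : ℕ => (k : ℝ) ≤ y), coeffA s n k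

/-- The standard normal distribution function. -/
noncomputable def stdNormalCDF (x : ℝ) : ℝ :=
  1 / Real.sqrt (2 * Real.pi) * ∫ t in Set.Iic x, Real.exp (-t ^ 2 / 2)

open MeasureTheory ProbabilityTheory Filter Topology Polynomial

/-! ### The generating polynomials -/

/-! Write `h` for `h_s`. The partial sums `S_n = P_0 + ⋯ + P_n` satisfy `S_n = (1 + x / h(n))
S_{n-1}`, so `P_{n+1}` is `x / h(n+1)` times a product of linear factors `1 + x / h(j)`, `1 ≤ j ≤
n`. Divided by its value at 1, it is the probability generating function of `1 + B_1 + ⋯ + B_n`,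
with independent Bernoulli variables `B_j` of parameters `1 / (1 + h(j))`
(`aeval_recPoly_div_eval_one`). The theorem is thus a central limit theorem, centred at the mean and
scaled by the standard deviation.

For `0 ≤ s ≤ 1` the variance dominates a multiple of the harmonic series and diverges
(`tendsto_sum_successProb_mul_one_sub`). As the summands are bounded, this forces the characteristic
functions to converge to the Gaussian one (`tendsto_prod_bernoulliCharFun`). Lévy's continuity
theorem then gives pointwise convergence of distribution functions, and Pólya's theorem
(`tendstoUniformly_of_tendsto_of_monotone`) makes it uniform. -/

theorem sum_range_recPoly (h : ℕ → ℝ) (n : ℕ) :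
    ∑ k ∈ Finset.range (n + 1), recPoly h k =
      ∏ j ∈ Finset.range n, (1 + C (1 / h (j + 1)) * X) := by
  induction n with
  | zero => simp [recPoly_zero]
  | succ n ih =>
    rw [Finset.sum_range_succ, recPoly_of_pos h (n + 1) (by omega), Finset.prod_range_succ, ← ih]
    ring

theorem recPoly_succ (h : ℕ → ℝ) (n : ℕ) :
    recPoly h (n + 1) =
      C (1 / h (n + 1)) * X * ∏ j ∈ Finset.range n, (1 + C (1 / h (j + 1)) * X) := by
  rw [recPoly_of_pos h (n + 1) (by omega), sum_range_recPoly]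

theorem natDegree_recPoly_le (h : ℕ → ℝ) (n : ℕ) : (recPoly h n).natDegree ≤ n := by
  cases n with
  | zero => simp [recPoly_zero]
  | succ n =>
    rw [recPoly_succ, mul_assoc]
    refine (natDegree_C_mul_le _ _).trans (natDegree_mul_le.trans ?_)
    have h1 : (∏ j ∈ Finset.range n, (1 + C (1 / h (j + 1)) * X : ℝ[X])).natDegree ≤ n := by
      refine (natDegree_prod_le _ _).trans ?_
      calc _ ≤ ∑ _j ∈ Finset.range n, 1 := Finset.sum_le_sum fun j _ => by
              refine (natDegree_add_le _ _).trans ?_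
              rw [natDegree_one, zero_max]
              exact (natDegree_C_mul_le _ _).trans natDegree_X_le
        _ = n := by simp
    have h2 : (X : ℝ[X]).natDegree ≤ 1 := natDegree_X_le
    omega

theorem coeff_recPoly_nonneg {h : ℕ → ℝ} (hh : ∀ n, 0 ≤ h n) (n k : ℕ) :
    0 ≤ (recPoly h n).coeff k := by
  induction n using Nat.strong_induction_on generalizing k with
  | _ n ih =>
    rcases Nat.eq_zero_or_pos n with rfl | hn
    · rw [recPoly_zero, coeff_one]
      split_ifs <;> norm_num
    · rw [recPoly_of_pos h n hn, mul_assoc, coeff_C_mul]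
      refine mul_nonneg (div_nonneg zero_le_one (hh n)) ?_
      cases k with
      | zero => simp
      | succ k =>
        rw [coeff_X_mul, finsetSum_coeff]
        exact Finset.sum_nonneg fun j hj => ih j (Finset.mem_range.1 hj) k

theorem eval_one_recPoly_pos {h : ℕ → ℝ} (hh : ∀ n, 0 < n → 0 < h n) (n : ℕ) :
    0 < (recPoly h n).eval 1 := by
  cases n with
  | zero => simp [recPoly_zero]
  | succ n =>
    have h0 := hh (n + 1) n.succ_pos
    have : 0 < ∏ j ∈ Finset.range n, (1 + 1 / h (j + 1)) := Finset.prod_pos fun j _ => by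
      have := hh (j + 1) j.succ_pos
      positivity
    rw [recPoly_succ]
    simp only [eval_mul, eval_C, eval_X, eval_prod, eval_add, eval_one, mul_one]
    positivity

/-- Each normalised factor is `(1 + z/h) / (1 + 1/h) = 1 + (z - 1) / (1 + h)`, the generating
function of a Bernoulli variable of parameter `1 / (1 + h)`. -/
theorem aeval_recPoly_div_eval_one {h : ℕ → ℝ} (hh : ∀ n, 0 < n → 0 < h n) (n : ℕ) (z : ℂ) :
    aeval z (recPoly h (n + 1)) / ((recPoly h (n + 1)).eval 1 : ℝ) =
      z * ∏ j ∈ Finset.range n, (1 + ((1 / (1 + h (j + 1)) : ℝ) : ℂ) * (z - 1)) := by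
  have h0 : (h (n + 1) : ℂ) ≠ 0 := by exact_mod_cast (hh (n + 1) n.succ_pos).ne'
  rw [recPoly_succ]
  simp only [eval_mul, eval_C, eval_X, eval_prod, eval_add, eval_one, mul_one, map_mul, map_prod,
    map_add, map_one, aeval_C, aeval_X, Complex.coe_algebraMap, Complex.ofReal_mul,
    Complex.ofReal_prod]
  have h1 : ((1 / h (n + 1) : ℝ) : ℂ) ≠ 0 := by
    rw [Complex.ofReal_div, Complex.ofReal_one]
    exact one_div_ne_zero h0
  rw [mul_assoc, mul_div_mul_left _ _ h1, mul_div_assoc, ← Finset.prod_div_distrib]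
  congr 1
  refine Finset.prod_congr rfl fun j _ => ?_
  have h2 := hh (j + 1) j.succ_pos
  have h3 : (h (j + 1) : ℂ) ≠ 0 := by exact_mod_cast h2.ne'
  have h4 : (1 + h (j + 1) : ℂ) ≠ 0 := by exact_mod_cast (by positivity : (1 + h (j + 1)) ≠ 0)
  have h5 : (h (j + 1) + 1 : ℂ) ≠ 0 := by rwa [add_comm]
  push_cast
  field_simp
  ring

/-! ### Finitely supported laws -/

/-- The measure on `ℝ` with mass `w k` at the point `x k` for each `k ∈ S`. -/
noncomputable def discreteLaw (S : Finset ℕ) (w x : ℕ → ℝ) : Measure ℝ :=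
  ∑ k ∈ S, ENNReal.ofReal (w k) • Measure.dirac (x k)

theorem isProbabilityMeasure_discreteLaw {S : Finset ℕ} {w : ℕ → ℝ} (hw : ∀ k ∈ S, 0 ≤ w k)
    (h1 : ∑ k ∈ S, w k = 1) (x : ℕ → ℝ) : IsProbabilityMeasure (discreteLaw S w x) := by
  constructor
  simp only [discreteLaw, Measure.coe_finsetSum, Finset.sum_apply, Measure.smul_apply,
    measure_univ, smul_eq_mul, mul_one]
  rw [← ENNReal.ofReal_sum_of_nonneg hw, h1, ENNReal.ofReal_one]

theorem discreteLaw_apply_Iic {S : Finset ℕ} {w : ℕ → ℝ} (hw : ∀ k ∈ S, 0 ≤ w k)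
    (x : ℕ → ℝ) (y : ℝ) :
    discreteLaw S w x (Set.Iic y) = ENNReal.ofReal (∑ k ∈ S.filter (fun k => x k ≤ y), w k) := by
  rw [ENNReal.ofReal_sum_of_nonneg fun k hk => hw k (Finset.mem_filter.1 hk).1, Finset.sum_filter]
  simp only [discreteLaw, Measure.coe_finsetSum, Finset.sum_apply, Measure.smul_apply,
    smul_eq_mul]
  refine Finset.sum_congr rfl fun k _ => ?_
  rw [Measure.dirac_apply' _ measurableSet_Iic]
  by_cases h : x k ≤ y <;> simp [h]

theorem charFun_discreteLaw {S : Finset ℕ} {w : ℕ → ℝ} (hw : ∀ k ∈ S, 0 ≤ w k)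
    (x : ℕ → ℝ) (t : ℝ) :
    charFun (discreteLaw S w x) t = ∑ k ∈ S, (w k : ℂ) * Complex.exp (t * x k * Complex.I) := by
  rw [charFun_apply_real, discreteLaw, integral_finsetSum_measure]
  · refine Finset.sum_congr rfl fun k hk => ?_
    rw [integral_smul_measure, integral_dirac, ENNReal.toReal_ofReal (hw k hk), Complex.real_smul]
  · intro k _
    exact (integrable_dirac (by simp)).smul_measure ENNReal.ofReal_ne_top

/-! ### Characteristic functions of centred sums of Bernoulli variables -/

theorem norm_exp_mul_I_sub_taylor_two_le {x : ℝ} (hx : |x| ≤ 1) :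
    ‖Complex.exp (x * Complex.I) - (1 + x * Complex.I - x ^ 2 / 2)‖ ≤ |x| ^ 3 := by
  have h' := Complex.exp_bound (x := (x : ℂ) * Complex.I) (by simpa using hx) (n := 3) (by norm_num)
  simp only [Finset.sum_range_succ, Finset.sum_range_zero, norm_mul, Complex.norm_I, mul_one,
    Complex.norm_real, Real.norm_eq_abs] at h'
  have e : (1 + x * Complex.I - x ^ 2 / 2 : ℂ) =
      0 + (x * Complex.I) ^ 0 / (Nat.factorial 0 : ℂ) + (x * Complex.I) ^ 1 / (Nat.factorial 1 : ℂ) +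
        (x * Complex.I) ^ 2 / (Nat.factorial 2 : ℂ) := by
    simp [mul_pow, Nat.factorial]
    ring
  rw [e]
  -- The constant in the exponential bound is `4 / (3! * 3) = 2/9`, here rounded up to 1.
  refine h'.trans (mul_le_of_le_one_right (by positivity) ?_)
  norm_num [Nat.factorial]

/-- The characteristic function at `u` of a centred Bernoulli variable of parameter `p`. -/
noncomputable def bernoulliCharFun (p u : ℝ) : ℂ :=
  (1 + p * (Complex.exp (u * Complex.I) - 1)) * Complex.exp (-(u * p * Complex.I))

/-- The centred variable is `-p` with probability `1 - p` and `1 - p` with probability `p`; this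
convex combination of unit complex numbers makes the norm bound immediate. -/
theorem bernoulliCharFun_eq (p u : ℝ) :
    bernoulliCharFun p u = (1 - p) * Complex.exp ((-(u * p) : ℝ) * Complex.I) +
      p * Complex.exp ((u * (1 - p) : ℝ) * Complex.I) := by
  have : Complex.exp ((u * (1 - p) : ℝ) * Complex.I) =
      Complex.exp (u * Complex.I) * Complex.exp (-(u * p * Complex.I)) := by
    rw [← Complex.exp_add]; push_cast; ring_nf
  rw [this, bernoulliCharFun]
  push_cast
  rw [neg_mul]
  ring

theorem norm_bernoulliCharFun_le_one {p : ℝ} (h0 : 0 ≤ p) (h1 : p ≤ 1) (u : ℝ) :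
    ‖bernoulliCharFun p u‖ ≤ 1 := by
  rw [bernoulliCharFun_eq]
  refine (norm_add_le _ _).trans (le_of_eq ?_)
  rw [norm_mul, norm_mul, Complex.norm_exp_ofReal_mul_I, Complex.norm_exp_ofReal_mul_I,
    ← Complex.ofReal_one, ← Complex.ofReal_sub, Complex.norm_real, Complex.norm_real,
    Real.norm_of_nonneg h0, Real.norm_of_nonneg (sub_nonneg.2 h1)]
  ring

/-- Centring cancels the linear terms, and the quadratic ones agree since the variance is `p * (1 -
p)`. The factor `p * (1 - p)` in the error is essential: summed over `j`, it yields the total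
variance rather than the number of terms. -/
theorem norm_bernoulliCharFun_sub_exp_le {p u : ℝ} (h0 : 0 ≤ p) (h1 : p ≤ 1) (hu : |u| ≤ 1) :
    ‖bernoulliCharFun p u - Complex.exp ((-(p * (1 - p) * u ^ 2 / 2) : ℝ))‖ ≤
      2 * (p * (1 - p) * |u| ^ 3) := by
  have hq : 0 ≤ 1 - p := sub_nonneg.2 h1
  have hu0 := abs_nonneg u
  have ha : |(-(u * p))| = |u| * p := by rw [abs_neg, abs_mul, abs_of_nonneg h0]
  have hb : |u * (1 - p)| = |u| * (1 - p) := by rw [abs_mul, abs_of_nonneg hq]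
  have A := norm_exp_mul_I_sub_taylor_two_le (x := -(u * p)) (by rw [ha]; nlinarith)
  have B := norm_exp_mul_I_sub_taylor_two_le (x := u * (1 - p)) (by rw [hb]; nlinarith)
  rw [ha] at A
  rw [hb] at B
  have hpq : p * (1 - p) ≤ 1 := by nlinarith
  have hpq0 : 0 ≤ p * (1 - p) := mul_nonneg h0 hq
  have hu2 : u ^ 2 = |u| ^ 2 := (sq_abs u).symm
  have hule : |u| ^ 2 ≤ 1 := pow_le_one₀ hu0 hu
  have hy : ‖(-(p * (1 - p) * u ^ 2 / 2) : ℝ)‖ = p * (1 - p) * |u| ^ 2 / 2 := by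
    rw [norm_neg, Real.norm_of_nonneg (by positivity), hu2]
  have hy1 : p * (1 - p) * |u| ^ 2 ≤ 1 := mul_le_one₀ hpq (by positivity) hule
  have E := Complex.norm_exp_sub_one_sub_id_le (x := ((-(p * (1 - p) * u ^ 2 / 2) : ℝ) : ℂ))
    (by rw [Complex.norm_real, hy]; linarith)
  rw [Complex.norm_real, hy] at E
  have key : bernoulliCharFun p u - Complex.exp ((-(p * (1 - p) * u ^ 2 / 2) : ℝ)) =
      ((1 - p : ℝ) : ℂ) * (Complex.exp ((-(u * p) : ℝ) * Complex.I) -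
          (1 + (-(u * p) : ℝ) * Complex.I - (-(u * p) : ℝ) ^ 2 / 2)) +
        (p : ℂ) * (Complex.exp ((u * (1 - p) : ℝ) * Complex.I) -
          (1 + (u * (1 - p) : ℝ) * Complex.I - (u * (1 - p) : ℝ) ^ 2 / 2)) -
        (Complex.exp ((-(p * (1 - p) * u ^ 2 / 2) : ℝ)) - 1 -
          ((-(p * (1 - p) * u ^ 2 / 2) : ℝ) : ℂ)) := by
    rw [bernoulliCharFun_eq]
    push_cast
    ring
  rw [key]
  refine (norm_sub_le _ _).trans ?_
  refine (add_le_add (norm_add_le _ _) E).trans ?_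
  rw [norm_mul, norm_mul, Complex.norm_real, Complex.norm_real, Real.norm_of_nonneg h0,
    Real.norm_of_nonneg hq]
  have A' := mul_le_mul_of_nonneg_left A hq
  have B' := mul_le_mul_of_nonneg_left B h0
  have e1 : (1 - p) * (|u| * p) ^ 3 + p * (|u| * (1 - p)) ^ 3 ≤ p * (1 - p) * |u| ^ 3 := by
    have : (1 - p) * (|u| * p) ^ 3 + p * (|u| * (1 - p)) ^ 3 =
        p * (1 - p) * |u| ^ 3 * (1 - 2 * (p * (1 - p))) := by ring
    rw [this]
    exact mul_le_of_le_one_right (by positivity) (by linarith)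
  have e2 : (p * (1 - p) * |u| ^ 2 / 2) ^ 2 ≤ p * (1 - p) * |u| ^ 3 := by
    have : (p * (1 - p) * |u| ^ 2 / 2) ^ 2 =
        p * (1 - p) * |u| ^ 3 * (p * (1 - p) * |u| / 4) := by ring
    rw [this]
    refine mul_le_of_le_one_right (by positivity) ?_
    have : p * (1 - p) * |u| ≤ 1 := mul_le_one₀ hpq hu0 hu
    linarith
  linarith

/-- Exchange the factors one at a time; all the others have norm at most 1. -/
theorem norm_prod_sub_prod_le_sum {ι : Type*} (s : Finset ι) (f g : ι → ℂ)
    (hf : ∀ i ∈ s, ‖f i‖ ≤ 1) (hg : ∀ i ∈ s, ‖g i‖ ≤ 1) :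
    ‖∏ i ∈ s, f i - ∏ i ∈ s, g i‖ ≤ ∑ i ∈ s, ‖f i - g i‖ := by
  classical
  induction s using Finset.induction_on with
  | empty => simp
  | insert i s his ih =>
    rw [Finset.prod_insert his, Finset.prod_insert his, Finset.sum_insert his]
    have h1 : f i * ∏ j ∈ s, f j - g i * ∏ j ∈ s, g j =
        (f i - g i) * ∏ j ∈ s, f j + g i * (∏ j ∈ s, f j - ∏ j ∈ s, g j) := by ring
    rw [h1]
    refine (norm_add_le _ _).trans (add_le_add ?_ ?_)
    · rw [norm_mul]
      refine mul_le_of_le_one_right (norm_nonneg _) ?_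
      rw [norm_prod]
      exact Finset.prod_le_one (fun _ _ => norm_nonneg _)
        fun j hj => hf j (Finset.mem_insert_of_mem hj)
    · rw [norm_mul]
      exact (mul_le_of_le_one_left (norm_nonneg _) (hg i (Finset.mem_insert_self _ _))).trans
        (ih (fun j hj => hf j (Finset.mem_insert_of_mem hj))
          fun j hj => hg j (Finset.mem_insert_of_mem hj))

/-- Central limit theorem for independent Bernoulli variables of parameters `p j`, in terms of
characteristic functions. -/
theorem tendsto_prod_bernoulliCharFun {p : ℕ → ℝ} (h0 : ∀ j, 0 ≤ p j) (h1 : ∀ j, p j ≤ 1)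
    (hV : Tendsto (fun n => ∑ j ∈ Finset.range n, p j * (1 - p j)) atTop atTop) (t : ℝ) :
    Tendsto (fun n => ∏ j ∈ Finset.range n,
        bernoulliCharFun (p j) (t / √(∑ i ∈ Finset.range n, p i * (1 - p i)))) atTop
      (𝓝 (Complex.exp (-t ^ 2 / 2))) := by
  set V : ℕ → ℝ := fun n => ∑ j ∈ Finset.range n, p j * (1 - p j) with hVdef
  have hb : Tendsto (fun n => √(V n)) atTop atTop := Real.tendsto_sqrt_atTop.comp hV
  rw [tendsto_iff_norm_sub_tendsto_zero]
  -- The summed errors are `2 * V n * |t / √(V n)| ^ 3`, which equals this bound.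
  refine squeeze_zero' (g := fun n => 2 * |t| ^ 3 / √(V n)) (.of_forall fun _ => norm_nonneg _) ?_
    (hb.const_div_atTop _)
  filter_upwards [hb.eventually_ge_atTop (max 1 |t|)] with n hn
  have hb0 : 0 < √(V n) := lt_of_lt_of_le one_pos ((le_max_left _ _).trans hn)
  have hVs : √(V n) ^ 2 = V n := Real.sq_sqrt (Real.sqrt_pos.1 hb0).le
  have hu : |t / √(V n)| ≤ 1 := by
    rw [abs_div, abs_of_pos hb0, div_le_one hb0]
    exact (le_max_right _ _).trans hn
  have hlim : Complex.exp (-t ^ 2 / 2) = ∏ j ∈ Finset.range n,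
      Complex.exp ((-(p j * (1 - p j) * (t / √(V n)) ^ 2 / 2) : ℝ)) := by
    rw [← Complex.exp_sum, ← Complex.ofReal_sum]
    have : ∑ j ∈ Finset.range n, -(p j * (1 - p j) * (t / √(V n)) ^ 2 / 2) = -t ^ 2 / 2 := by
      have e : ∀ j, -(p j * (1 - p j) * (t / √(V n)) ^ 2 / 2) =
          p j * (1 - p j) * (-(t / √(V n)) ^ 2 / 2) := fun j => by ring
      simp_rw [e]
      rw [← Finset.sum_mul]
      change V n * _ = _
      rw [div_pow, hVs]
      have : V n ≠ 0 := (Real.sqrt_pos.1 hb0).ne'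
      field_simp
    rw [this]
    push_cast
    rfl
  rw [hlim]
  refine (norm_prod_sub_prod_le_sum _ _ _
    (fun j _ => norm_bernoulliCharFun_le_one (h0 j) (h1 j) _) fun j _ => ?_).trans ?_
  · rw [Complex.norm_exp_ofReal, Real.exp_le_one_iff, neg_nonpos]
    have := h0 j
    have := sub_nonneg.2 (h1 j)
    positivity
  · refine (Finset.sum_le_sum fun j _ =>
      norm_bernoulliCharFun_sub_exp_le (h0 j) (h1 j) hu).trans (le_of_eq ?_)
    rw [← Finset.mul_sum, ← Finset.sum_mul]
    change 2 * (V n * _) = _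
    have hV0 : √(V n) ≠ 0 := hb0.ne'
    rw [abs_div, abs_of_pos hb0, div_pow]
    nth_rewrite 1 [← hVs]
    field_simp

/-! ### Pointwise convergence of distribution functions is uniform -/

/-- **Pólya's theorem**: monotone functions with values in `[0, 1]` converging pointwise to a
continuous distribution function converge uniformly. -/
theorem tendstoUniformly_of_tendsto_of_monotone {ι : Type*} {l : Filter ι} {F : ι → ℝ → ℝ}
    {G : ℝ → ℝ}
    (hF : ∀ᶠ i in l, Monotone (F i)) (hF0 : ∀ i x, 0 ≤ F i x) (hF1 : ∀ i x, F i x ≤ 1)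
    (hG : Monotone G) (hGc : Continuous G) (hbot : Tendsto G atBot (𝓝 0))
    (htop : Tendsto G atTop (𝓝 1)) (h : ∀ x, Tendsto (fun i => F i x) l (𝓝 (G x))) :
    TendstoUniformly F G l := by
  have hG0 : ∀ x, 0 ≤ G x := fun x => hG.le_of_tendsto hbot x
  have hG1 : ∀ x, G x ≤ 1 := fun x => hG.ge_of_tendsto htop x
  rw [Metric.tendstoUniformly_iff]
  intro ε hε
  -- One `1 / m` pays for the gap between consecutive levels `k / m` of `G`, the other for the error
  -- of `F i` at the grid points.
  obtain ⟨m, hm⟩ := exists_nat_gt (2 / ε)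
  have hm0 : (0 : ℝ) < m := lt_trans (by positivity) hm
  have hmε : 2 / (m : ℝ) < ε := by
    rw [div_lt_iff₀ hε] at hm
    rw [div_lt_iff₀ hm0]
    linarith
  -- Only interior levels are sought, since `G` need not attain 0 or 1; the bounds `0 ≤ F i x ≤ 1`
  -- serve at the two ends.
  have hex : ∀ k : ℕ, ∃ x, 0 < k → k < m → G x = k / m := by
    intro k
    by_cases hk : 0 < k ∧ k < m
    · have hk0 : (0 : ℝ) < k / m := div_pos (by exact_mod_cast hk.1) hm0
      have hk1 : (k : ℝ) / m < 1 := (div_lt_one hm0).2 (by exact_mod_cast hk.2)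
      obtain ⟨x, hx⟩ := mem_range_of_exists_le_of_exists_ge hGc
        ((hbot.eventually_lt_const hk0).exists.imp fun _ h => h.le)
        ((htop.eventually_const_lt hk1).exists.imp fun _ h => h.le)
      exact ⟨x, fun _ _ => hx⟩
    · exact ⟨0, fun h1 h2 => absurd ⟨h1, h2⟩ hk⟩
  choose g hg using hex
  have hev : ∀ᶠ i in l, ∀ k ∈ Finset.range m, dist (F i (g k)) (G (g k)) < 1 / m :=
    (Filter.eventually_all_finset _).2 fun k _ =>
      (Metric.tendsto_nhds.1 (h (g k))) _ (by positivity)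
  filter_upwards [hF, hev] with i hi hik x
  rw [Real.dist_eq, abs_lt]
  have hmG : 0 ≤ m * G x := mul_nonneg hm0.le (hG0 x)
  have h2m : 2 / (m : ℝ) = 1 / m + 1 / m := by ring
  constructor
  -- Upper bound on `F i x`: `k / m` is the first level strictly above `G x`.
  · set k := ⌊m * G x⌋₊ + 1 with hk
    have hlt : m * G x < k := by
      rw [hk]; push_cast; exact Nat.lt_floor_add_one _
    have hle : (k : ℝ) ≤ m * G x + 1 := by
      rw [hk]; push_cast; linarith [Nat.floor_le hmG]
    have hle' : (k : ℝ) / m ≤ G x + 1 / m := by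
      rw [div_le_iff₀ hm0, add_mul, one_div_mul_cancel hm0.ne']; linarith
    have hlt' : G x < k / m := by rw [lt_div_iff₀ hm0]; linarith
    by_cases hkm : k < m
    · have e := hg k (by omega) hkm
      have hx : x ≤ g k := by
        by_contra! hc
        have := hG hc.le
        rw [e] at this
        linarith
      have := hik k (Finset.mem_range.2 hkm)
      rw [Real.dist_eq, abs_lt, e] at this
      have := hi hx
      linarith [this]
    · have : (1 : ℝ) ≤ k / m := (one_le_div hm0).2 (by exact_mod_cast not_lt.1 hkm)
      have := hF1 i x
      have : 0 < 1 / (m : ℝ) := by positivity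
      linarith
  -- Lower bound on `F i x`: `k / m` is the last level strictly below `G x`. If `k = 0`, truncation
  -- at `G x = 0` included, then `G x ≤ 1 / m` and nonnegativity of `F i x` suffices.
  · set k := ⌈m * G x⌉₊ - 1 with hk
    by_cases hk0 : 0 < k
    · have hc : ⌈m * G x⌉₊ = k + 1 := by omega
      have hc1 : m * G x ≤ k + 1 := by
        have := Nat.le_ceil (m * G x); rw [hc] at this; exact_mod_cast this
      have hc2 : (k : ℝ) < m * G x := Nat.lt_ceil.1 (by omega)
      have hle' : G x ≤ k / m + 1 / m := by
        rw [← add_div, le_div_iff₀ hm0]; linarith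
      have hlt' : k / m < G x := by rw [div_lt_iff₀ hm0]; linarith
      have hkm : k < m := by
        have : (k : ℝ) < m := hc2.trans_le (mul_le_of_le_one_right hm0.le (hG1 x))
        exact_mod_cast this
      have e := hg k hk0 hkm
      have hx : g k ≤ x := by
        by_contra! hcc
        have := hG hcc.le
        rw [e] at this
        linarith
      have := hik k (Finset.mem_range.2 hkm)
      rw [Real.dist_eq, abs_lt, e] at this
      have := hi hx
      linarith [this]
    · have hc : ⌈m * G x⌉₊ ≤ 1 := by omega
      have hc1 : m * G x ≤ 1 := by
        have := Nat.ceil_le.1 hc; exact_mod_cast this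
      have : G x ≤ 1 / m := by rw [le_div_iff₀ hm0]; linarith
      have := hF0 i x
      have : 0 < 1 / (m : ℝ) := by positivity
      linarith

theorem tendsto_iSup_abs_sub_of_tendstoUniformly {ι : Type*} {l : Filter ι} {F : ι → ℝ → ℝ}
    {G : ℝ → ℝ} (h : TendstoUniformly F G l) :
    Tendsto (fun i => ⨆ x, |F i x - G x|) l (𝓝 0) := by
  rw [Metric.tendsto_nhds]
  intro ε hε
  -- A strict bound weakens to `≤` under the supremum, hence `ε / 2`.
  filter_upwards [Metric.tendstoUniformly_iff.1 h (ε / 2) (half_pos hε)] with i hi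
  have h1 : ⨆ x, |F i x - G x| ≤ ε / 2 := ciSup_le fun x => by
    have := (hi x).le
    rwa [dist_comm, Real.dist_eq] at this
  have h2 : 0 ≤ ⨆ x, |F i x - G x| := Real.iSup_nonneg fun x => abs_nonneg _
  rw [Real.dist_eq, sub_zero, abs_of_nonneg h2]
  linarith

/-! ### The standard normal distribution function -/

theorem stdNormalCDF_eq_cdf : stdNormalCDF = cdf (gaussianReal 0 1) := by
  ext x
  rw [cdf_eq_real, Measure.real, gaussianReal_apply_eq_integral 0 one_ne_zero,
    ENNReal.toReal_ofReal (setIntegral_nonneg measurableSet_Iic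
      fun y _ => gaussianPDFReal_nonneg 0 1 y), stdNormalCDF, ← integral_const_mul]
  refine integral_congr_ae (.of_forall fun y => ?_)
  simp [gaussianPDFReal]

theorem continuous_stdNormalCDF : Continuous stdNormalCDF := by
  have hint : Integrable fun t : ℝ => Real.exp (-t ^ 2 / 2) := by
    refine (integrable_exp_neg_mul_sq (b := 1 / 2) (by norm_num)).congr (.of_forall fun t => ?_)
    simp only
    congr 1
    ring
  have : ∀ x, stdNormalCDF x = 1 / √(2 * Real.pi) *
      ((∫ t in Set.Iic 0, Real.exp (-t ^ 2 / 2)) + ∫ t in (0 : ℝ)..x, Real.exp (-t ^ 2 / 2)) := by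
    intro x
    rw [stdNormalCDF, ← intervalIntegral.integral_Iic_sub_Iic hint.integrableOn hint.integrableOn]
    ring
  rw [funext this]
  exact continuous_const.mul (continuous_const.add
    (intervalIntegral.continuous_primitive (fun _ _ => hint.intervalIntegrable) 0))

/-! ### The normalised coefficients as probability laws -/

theorem hWeight_pos (s : ℝ) {n : ℕ} (hn : 0 < n) : 0 < hWeight s n :=
  Real.rpow_pos_of_pos (by exact_mod_cast hn) s

theorem hWeight_nonneg (s : ℝ) (n : ℕ) : 0 ≤ hWeight s n :=
  Real.rpow_nonneg n.cast_nonneg s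

/-- The weights `A_{n,k}(s) / P_n^{h_s}(1)`. -/
noncomputable def coeffWeight (s : ℝ) (n k : ℕ) : ℝ :=
  coeffA s n k / (recPoly (hWeight s) n).eval 1

theorem coeffWeight_nonneg (s : ℝ) (n k : ℕ) : 0 ≤ coeffWeight s n k :=
  div_nonneg (coeff_recPoly_nonneg (hWeight_nonneg s) n k)
    (eval_one_recPoly_pos (fun _ => hWeight_pos s) n).le

theorem sum_coeffWeight (s : ℝ) (n : ℕ) : ∑ k ∈ Finset.range (n + 1), coeffWeight s n k = 1 := by
  have h := eval_eq_sum_range' (Nat.lt_succ_of_le (natDegree_recPoly_le (hWeight s) n)) 1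
  simp only [one_pow, mul_one] at h
  simp only [coeffWeight, coeffA]
  rw [← Finset.sum_div, ← h, div_self (eval_one_recPoly_pos (fun _ => hWeight_pos s) n).ne']

theorem normPartialSum_eq (s : ℝ) (n : ℕ) (y : ℝ) :
    normPartialSum s n y =
      ∑ k ∈ (Finset.range (n + 1)).filter (fun k : ℕ => (k : ℝ) ≤ y), coeffWeight s n k := by
  simp only [normPartialSum, coeffWeight]
  rw [← Finset.sum_div, one_div_mul_eq_div]

theorem normPartialSum_nonneg (s : ℝ) (n : ℕ) (y : ℝ) : 0 ≤ normPartialSum s n y := by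
  rw [normPartialSum_eq]
  exact Finset.sum_nonneg fun k _ => coeffWeight_nonneg s n k

theorem normPartialSum_mono (s : ℝ) (n : ℕ) : Monotone (normPartialSum s n) := by
  intro y z hyz
  rw [normPartialSum_eq, normPartialSum_eq]
  refine Finset.sum_le_sum_of_subset_of_nonneg (fun k hk => ?_)
    fun k _ _ => coeffWeight_nonneg s n k
  rw [Finset.mem_filter] at hk ⊢
  exact ⟨hk.1, hk.2.trans hyz⟩

theorem normPartialSum_le_one (s : ℝ) (n : ℕ) (y : ℝ) : normPartialSum s n y ≤ 1 := by
  rw [normPartialSum_eq, ← sum_coeffWeight s n]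
  exact Finset.sum_le_sum_of_subset_of_nonneg (Finset.filter_subset _ _)
    fun k _ _ => coeffWeight_nonneg s n k

/-- The law of `(K - a) / b`, where `K` takes the value `k` with probability
`A_{n,k}(s) / P_n^{h_s}(1)`. -/
noncomputable def coeffLaw (s : ℝ) (n : ℕ) (a b : ℝ) : ProbabilityMeasure ℝ :=
  ⟨discreteLaw (Finset.range (n + 1)) (coeffWeight s n) fun k => (k - a) / b,
    isProbabilityMeasure_discreteLaw (fun k _ => coeffWeight_nonneg s n k) (sum_coeffWeight s n) _⟩

theorem coeffLaw_apply_Iic (s : ℝ) (n : ℕ) (a : ℝ) {b : ℝ} (hb : 0 < b) (x : ℝ) :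
    (coeffLaw s n a b : Measure ℝ) (Set.Iic x) =
      ENNReal.ofReal (normPartialSum s n (a + x * b)) := by
  rw [normPartialSum_eq]
  refine (discreteLaw_apply_Iic (S := Finset.range (n + 1)) (w := coeffWeight s n)
    (fun k _ => coeffWeight_nonneg s n k) (fun k => (k - a) / b) x).trans ?_
  congr 2
  refine Finset.filter_congr fun k _ => ?_
  rw [div_le_iff₀ hb, sub_le_iff_le_add']

/-- The success probabilities `1 / (1 + h_s(j + 1))`. -/
noncomputable def successProb (s : ℝ) (j : ℕ) : ℝ := 1 / (1 + hWeight s (j + 1))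

theorem successProb_nonneg (s : ℝ) (j : ℕ) : 0 ≤ successProb s j := by
  have := hWeight_nonneg s (j + 1)
  unfold successProb
  positivity

theorem successProb_le_one (s : ℝ) (j : ℕ) : successProb s j ≤ 1 := by
  have := hWeight_nonneg s (j + 1)
  exact (div_le_one (by positivity)).2 (by linarith)

/-- This is where `s ∈ [0, 1]` enters: `s ≥ 0` gives `1 ≤ h`, so `h / (1 + h) ^ 2 ≥ 1 / (4 * h)`,
and `s ≤ 1` gives `h ≤ j + 1`, so the harmonic series is a minorant. -/
theorem tendsto_sum_successProb_mul_one_sub {s : ℝ} (hs : s ∈ Set.Icc (0 : ℝ) 1) :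
    Tendsto (fun n => ∑ j ∈ Finset.range n, successProb s j * (1 - successProb s j))
      atTop atTop := by
  have hdiv : Tendsto (fun n => 1 / 4 * ∑ j ∈ Finset.range n, 1 / ((j : ℝ) + 1)) atTop atTop :=
    Real.tendsto_sum_range_one_div_nat_succ_atTop.const_mul_atTop (by norm_num)
  refine tendsto_atTop_mono (fun n => ?_) hdiv
  rw [Finset.mul_sum]
  refine Finset.sum_le_sum fun j _ => ?_
  have hj : (1 : ℝ) ≤ ((j + 1 : ℕ) : ℝ) := by push_cast; linarith [j.cast_nonneg (α := ℝ)]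
  have h1 : 1 ≤ hWeight s (j + 1) := Real.one_le_rpow hj hs.1
  have h2 : hWeight s (j + 1) ≤ (j : ℝ) + 1 := by
    have := Real.rpow_le_rpow_of_exponent_le hj hs.2
    rw [Real.rpow_one] at this
    unfold hWeight
    exact_mod_cast this
  set h := hWeight s (j + 1)
  have hp : successProb s j * (1 - successProb s j) = h / (1 + h) ^ 2 := by
    change 1 / (1 + h) * (1 - 1 / (1 + h)) = _
    field_simp
    ring
  rw [hp]
  calc 1 / 4 * (1 / ((j : ℝ) + 1)) ≤ 1 / 4 * (1 / h) := by gcongr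
    _ ≤ h / (1 + h) ^ 2 := by
      rw [one_div_mul_one_div, div_le_div_iff₀ (by positivity) (by positivity)]
      nlinarith

/-- The leading factor `x` of the polynomial shifts the law by 1; the summand 1 in the centring
cancels it, leaving only centred Bernoulli factors. -/
theorem charFun_coeffLaw (s : ℝ) (n : ℕ) (b t : ℝ) :
    charFun (coeffLaw s (n + 1) (1 + ∑ j ∈ Finset.range n, successProb s j) b : Measure ℝ) t =
      ∏ j ∈ Finset.range n, bernoulliCharFun (successProb s j) (t / b) := by
  set a := 1 + ∑ j ∈ Finset.range n, successProb s j with ha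
  set z := Complex.exp ((t / b : ℝ) * Complex.I) with hz
  have h1 : charFun (coeffLaw s (n + 1) a b : Measure ℝ) t =
      aeval z (recPoly (hWeight s) (n + 1)) / ((recPoly (hWeight s) (n + 1)).eval 1 : ℝ) *
        Complex.exp (-((t / b : ℝ) * a * Complex.I)) := by
    refine (charFun_discreteLaw (S := Finset.range (n + 1 + 1)) (w := coeffWeight s (n + 1))
      (fun k _ => coeffWeight_nonneg s (n + 1) k) (fun k => (k - a) / b) t).trans ?_
    rw [aeval_eq_sum_range' (Nat.lt_succ_of_le (natDegree_recPoly_le (hWeight s) (n + 1))),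
      Finset.sum_div, Finset.sum_mul]
    refine Finset.sum_congr rfl fun k _ => ?_
    have e : Complex.exp (t * (((k : ℝ) - a) / b : ℝ) * Complex.I) =
        z ^ k * Complex.exp (-((t / b : ℝ) * a * Complex.I)) := by
      rw [hz, ← Complex.exp_nat_mul, ← Complex.exp_add]
      push_cast
      ring_nf
    rw [e, coeffWeight, coeffA, Complex.ofReal_div, Complex.real_smul]
    ring
  rw [h1, aeval_recPoly_div_eval_one fun _ => hWeight_pos s]
  simp only [bernoulliCharFun]
  rw [Finset.prod_mul_distrib, ← Complex.exp_sum]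
  have e : Complex.exp (-((t / b : ℝ) * a * Complex.I)) =
      Complex.exp (-((t / b : ℝ) * Complex.I)) *
        Complex.exp (∑ j ∈ Finset.range n, -((t / b : ℝ) * successProb s j * Complex.I)) := by
    rw [← Complex.exp_add, Finset.sum_neg_distrib, ← Finset.sum_mul, ← Finset.mul_sum, ha]
    push_cast
    ring_nf
  have hz1 : z * Complex.exp (-((t / b : ℝ) * Complex.I)) = 1 := by
    rw [hz, ← Complex.exp_add, add_neg_cancel, Complex.exp_zero]
  rw [e]
  calc _ = (z * Complex.exp (-((t / b : ℝ) * Complex.I))) *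
        ((∏ j ∈ Finset.range n, (1 + ((1 / (1 + hWeight s (j + 1)) : ℝ) : ℂ) * (z - 1))) *
          Complex.exp (∑ j ∈ Finset.range n, -((t / b : ℝ) * successProb s j * Complex.I))) := by
        ring
    _ = _ := by rw [hz1, one_mul]; rfl

theorem theorem1 (s : ℝ) (hs : s ∈ Set.Icc (0 : ℝ) 1) :
    ∃ a b : ℕ → ℝ,
      (∀ᶠ n in Filter.atTop, 0 < b n) ∧
      (∀ n : ℕ, BddAbove (Set.range fun x : ℝ =>
        |normPartialSum s n (a n + x * b n) - stdNormalCDF x|)) ∧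
      Filter.Tendsto
        (fun n : ℕ => ⨆ x : ℝ, |normPartialSum s n (a n + x * b n) - stdNormalCDF x|)
        Filter.atTop (nhds 0) := by
  set V : ℕ → ℝ := fun n => ∑ j ∈ Finset.range n, successProb s j * (1 - successProb s j) with hV
  have hVt : Tendsto V atTop atTop := tendsto_sum_successProb_mul_one_sub hs
  have hbt : Tendsto (fun n => √(V n)) atTop atTop := Real.tendsto_sqrt_atTop.comp hVt
  have hG0 : ∀ x, 0 ≤ stdNormalCDF x := fun x => by
    rw [stdNormalCDF_eq_cdf]; exact cdf_nonneg _ x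
  have hG1 : ∀ x, stdNormalCDF x ≤ 1 := fun x => by
    rw [stdNormalCDF_eq_cdf]; exact cdf_le_one _ x
  -- Mean and standard deviation: for `n ≥ 1`, `P_n` has `n - 1` Bernoulli factors. The scale
  -- vanishes for `n = 0` and `n = 1`, so positivity is only eventual.
  refine ⟨fun n => 1 + ∑ j ∈ Finset.range (n - 1), successProb s j, fun n => √(V (n - 1)),
    ?_, fun n => ?_, ?_⟩
  · exact (hbt.comp (tendsto_sub_atTop_nat 1)).eventually_gt_atTop 0
  · refine ⟨1, ?_⟩
    rintro _ ⟨x, rfl⟩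
    have h1 := normPartialSum_nonneg s n
      (1 + ∑ j ∈ Finset.range (n - 1), successProb s j + x * √(V (n - 1)))
    have h2 := normPartialSum_le_one s n
      (1 + ∑ j ∈ Finset.range (n - 1), successProb s j + x * √(V (n - 1)))
    exact abs_le.2 ⟨by linarith [hG1 x], by linarith [hG0 x]⟩
  · rw [← tendsto_add_atTop_iff_nat 1]
    simp only [Nat.add_sub_cancel]
    refine tendsto_iSup_abs_sub_of_tendstoUniformly (F := fun n x =>
      normPartialSum s (n + 1) (1 + ∑ j ∈ Finset.range n, successProb s j + x * √(V n))) ?_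
    refine tendstoUniformly_of_tendsto_of_monotone (.of_forall fun n x y hxy => ?_)
      (fun _ _ => normPartialSum_nonneg _ _ _) (fun _ _ => normPartialSum_le_one _ _ _) ?_
      continuous_stdNormalCDF ?_ ?_ fun x => ?_
    · exact normPartialSum_mono s (n + 1)
        (by linarith [mul_le_mul_of_nonneg_right hxy (Real.sqrt_nonneg (V n))])
    · rw [stdNormalCDF_eq_cdf]; exact monotone_cdf _
    · rw [stdNormalCDF_eq_cdf]; exact tendsto_cdf_atBot _
    · rw [stdNormalCDF_eq_cdf]; exact tendsto_cdf_atTop _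
    · let γ : ProbabilityMeasure ℝ := ⟨gaussianReal 0 1, inferInstance⟩
      have hlim : Tendsto (fun n => coeffLaw s (n + 1)
          (1 + ∑ j ∈ Finset.range n, successProb s j) (√(V n))) atTop (𝓝 γ) := by
        refine ProbabilityMeasure.tendsto_of_tendsto_charFun fun t => ?_
        have hγ : charFun (γ : Measure ℝ) t = Complex.exp (-t ^ 2 / 2) := by
          refine (charFun_gaussianReal t).trans ?_
          simp [neg_div]
        rw [hγ]
        simp_rw [charFun_coeffLaw]
        exact tendsto_prod_bernoulliCharFun (successProb_nonneg s) (successProb_le_one s) hVt t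
      -- The Gaussian has no atoms, so the portmanteau theorem applies to every half-line.
      have hfr : (γ : Measure ℝ) (frontier (Set.Iic x)) = 0 := by
        rw [frontier_Iic]
        have := nullSingletonClass_gaussianReal (μ := 0) (v := 1) one_ne_zero
        exact measure_singleton (μ := gaussianReal 0 1) x
      have h := ProbabilityMeasure.tendsto_measure_of_null_frontier_of_tendsto' hlim hfr
      have h' := (ENNReal.tendsto_toReal (measure_ne_top (γ : Measure ℝ) _)).comp h
      rw [stdNormalCDF_eq_cdf, cdf_eq_real]
      refine h'.congr' ?_
      filter_upwards [hbt.eventually_gt_atTop 0] with n hn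
      simp only [Function.comp_apply]
      rw [coeffLaw_apply_Iic s (n + 1) _ hn, ENNReal.toReal_ofReal (normPartialSum_nonneg _ _ _)]
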